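/- Let $d \ge 2$ be an integer. Let $\Phi_d$ be the cumulative distribution function of the chi-squared distribution with $d$ degrees of freedom, $\Psi_d(r) = 1 - \Phi_d(r^2)$ for $r \ge 0$ and $\Psi_d(r) = 1$ for $r < 0$, and $\Delta\Psi_d(R_1,R_2) = \Psi_d(R_1) - \Psi_d(R_2)$. Let $I_x(a,b) = \frac{1}{B(a,b)}\int_0^x t^{a-1}(1-t)^{b-1}\,dt$ be the regularized incomplete Euler beta function, where $B$ is the Euler beta function, and put $\mathcal{I}(x) = I_{1-x^2}\left(\frac{d-1}{2},\frac12\right)$, so that $\mathcal{I}(\cos\theta) = I_{\sin^2\theta}\left(\frac{d-1}{2},\frac12\right)$. For $R \ge 0$, $v \in \mathbb{R}^d\setminus\{0\}$ and $\theta\in[0,\pi/2]$, let $$S(0,R,v,\theta) = \{x \in \mathbb{R}^d : \|x\|_2 \le R,\ \langle x, v\rangle \ge \|x\|_2\,\|v\|_2\cos\theta\}$$ be the spherical sector of the ball of center $0$ and radius $R$ with axis $v$ and angle $\theta$ (measured from the axis), and let $\Delta S(0,R_2,R_1,v,\theta) = S(0,R_2,v,\theta)\smallsetminus S(0,R_1,v,\theta)$.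 Lemma (probability of a spherical-sector shell). Let $z \sim \mathcal{N}(0, I_d)$, $0 \le R_1 \le R_2$, $v \in \mathbb{R}^d\setminus\{0\}$ and $\theta \in [0,\pi/2]$. Then $$\mathbb{P}\left(z \in \Delta S(0,R_2,R_1,v,\theta)\right) = \frac{\mathcal{I}(\cos\theta)}{2}\,\Delta\Psi_d(R_1,R_2).$$ -/

import Mathlib

open MeasureTheory ProbabilityTheory

namespace SphericalSector

/-- The cumulative distribution function `Φ_d` of the chi-squared distribution with `d` degrees
of freedom, that is, of the Gamma distribution of shape `d / 2` and rate `1 / 2`. -/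
noncomputable def chiSqCDF (d : ℕ) (x : ℝ) : ℝ :=
  cdf (gammaMeasure ((d : ℝ) / 2) (1 / 2)) x

/-- `Ψ_d(r) = 1 - Φ_d(r²)` for `r ≥ 0`, and `Ψ_d(r) = 1` for `r < 0`. -/
noncomputable def Psi (d : ℕ) (r : ℝ) : ℝ :=
  if 0 ≤ r then 1 - chiSqCDF d (r ^ 2) else 1

/-- `ΔΨ_d(R₁, R₂) = Ψ_d(R₁) - Ψ_d(R₂)`. -/
noncomputable def deltaPsi (d : ℕ) (R₁ R₂ : ℝ) : ℝ :=
  Psi d R₁ - Psi d R₂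

/-- The regularized incomplete Euler beta function `I_x(a, b)`. -/
noncomputable def regIncBeta (x a b : ℝ) : ℝ :=
  1 / ProbabilityTheory.beta a b * ∫ t in (0 : ℝ)..x, t ^ (a - 1) * (1 - t) ^ (b - 1)

/-- `ℐ(x) = I_{1 - x²}((d - 1) / 2, 1 / 2)`; thus `ℐ(cos θ) = I_{sin² θ}((d - 1) / 2, 1 / 2)`. -/
noncomputable def sectorI (d : ℕ) (x : ℝ) : ℝ :=
  regIncBeta (1 - x ^ 2) (((d : ℝ) - 1) / 2) (1 / 2)

/-- The spherical sector of the closed ball of center `c` and radius `R`, with axis `v` and angle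
`θ`: the points `x` of the ball such that `x - c` makes an angle at most `θ` with `v`
(the apex `c` included), written as `‖x - c‖ ‖v‖ cos θ ≤ ⟪x - c, v⟫`. -/
def sector {d : ℕ} (c : EuclideanSpace ℝ (Fin d)) (R : ℝ) (v : EuclideanSpace ℝ (Fin d))
    (θ : ℝ) : Set (EuclideanSpace ℝ (Fin d)) :=
  {x | x ∈ Metric.closedBall c R ∧ ‖x - c‖ * ‖v‖ * Real.cos θ ≤ inner ℝ (x - c) v}

/-- The inequality in `sector` is the condition on the angle. -/
theorem mem_sector_iff_angle {d : ℕ} {c v x : EuclideanSpace ℝ (Fin d)} {R θ : ℝ}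
    (hv : v ≠ 0) (hx : x ≠ c) (h0 : 0 ≤ θ) (hpi : θ ≤ Real.pi) :
    x ∈ sector c R v θ ↔
      x ∈ Metric.closedBall c R ∧ InnerProductGeometry.angle (x - c) v ≤ θ := by
  have h1 : 0 < ‖x - c‖ * ‖v‖ :=
    mul_pos (norm_pos_iff.2 (sub_ne_zero.2 hx)) (norm_pos_iff.2 hv)
  unfold sector
  simp only [Set.mem_ofPred_eq]
  refine and_congr_right fun _ => ?_
  rw [← InnerProductGeometry.cos_angle_mul_norm_mul_norm (x - c) v, mul_comm _ (Real.cos θ),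
    mul_le_mul_iff_left₀ h1]
  exact Real.strictAntiOn_cos.le_iff_ge ⟨h0, hpi⟩
    ⟨InnerProductGeometry.angle_nonneg _ _, InnerProductGeometry.angle_le_pi _ _⟩

/-- The sector shell `ΔS(c, R₂, R₁, v, θ) = S(c, R₂, v, θ) \ S(c, R₁, v, θ)`. -/
def sectorShell {d : ℕ} (c : EuclideanSpace ℝ (Fin d)) (R₂ R₁ : ℝ)
    (v : EuclideanSpace ℝ (Fin d)) (θ : ℝ) : Set (EuclideanSpace ℝ (Fin d)) :=
  sector c R₂ v θ \ sector c R₁ v θ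

end SphericalSector

open MeasureTheory ProbabilityTheory

namespace SphericalSector

open scoped ENNReal

/-! In an orthonormal basis whose first vector points along `v`, the coordinates of `z` are
independent standard Gaussians. Let `X` be the first one and `Y` the sum of the squares of the
others. Off the null set `X = 0`, the shell is the event `X > 0`, `R₁² < Y + X² ≤ R₂²`, `Y / (Y +
X²) ≤ sin² θ`.

On `X > 0`, the law of `X²` is half of Gamma(1/2, 1/2) (`map_sq_restrict_Ioi_gaussianReal`), and `Y`
is Gamma((d-1)/2, 1/2) (`map_sum_sq_pi_gaussianReal`). By the beta-gamma factorization
(`map_gammaMeasure_prod`), sum and ratio are independent, Gamma(d/2, 1/2) and Beta((d-1)/2, 1/2).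
The probability is thus a product of 1/2, a radial factor and an angular factor. -/

lemma measurable_gammaPDF (a r : ℝ) : Measurable (gammaPDF a r) :=
  (measurable_gammaPDFReal a r).ennreal_ofReal

lemma measurable_betaPDF (a b : ℝ) : Measurable (betaPDF a b) :=
  (measurable_betaPDFReal a b).ennreal_ofReal

/-! ### Beta-gamma factorization. -/

lemma lintegral_eq_mul_lintegral_comp_mul_left {s : ℝ} (hs : 0 < s) (g : ℝ → ℝ≥0∞)
    (hg : Measurable g) :
    ∫⁻ x, g x = ENNReal.ofReal s * ∫⁻ t, g (s * t) := by
  conv_lhs => rw [← Real.smul_map_volume_mul_left hs.ne']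
  rw [lintegral_smul_measure, lintegral_map hg (by fun_prop), abs_of_pos hs, smul_eq_mul]

/-- The Jacobian identity behind the beta-gamma factorization. -/
lemma gammaPDF_mul_gammaPDF {a b r s t : ℝ} (ha : 0 < a) (hb : 0 < b) (hr : 0 < r)
    (hs : 0 < s) (ht0 : t ≠ 0) (ht1 : t ≠ 1) :
    ENNReal.ofReal s * (gammaPDF a r (s * t) * gammaPDF b r (s - s * t)) =
      gammaPDF (a + b) r s * betaPDF a b t := by
  rcases lt_or_gt_of_ne ht0 with h0 | h0
  · rw [gammaPDF_of_neg (mul_neg_of_pos_of_neg hs h0), betaPDF_eq_zero_of_nonpos h0.le]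
    simp
  rcases lt_or_gt_of_ne ht1 with h1 | h1
  · have h1' : 0 < 1 - t := by linarith
    have e : s - s * t = s * (1 - t) := by ring
    rw [e, gammaPDF_of_nonneg (by positivity), gammaPDF_of_nonneg (by positivity),
      gammaPDF_of_nonneg hs.le, betaPDF_of_pos_lt_one h0 h1,
      ← ENNReal.ofReal_mul (by positivity), ← ENNReal.ofReal_mul (by positivity),
      ← ENNReal.ofReal_mul (by positivity)]
    congr 1
    have hA := Real.Gamma_pos_of_pos ha
    have hB := Real.Gamma_pos_of_pos hb
    have hAB := Real.Gamma_pos_of_pos (add_pos ha hb)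
    have e1 : Real.exp (-(r * (s * t))) * Real.exp (-(r * (s * (1 - t)))) =
        Real.exp (-(r * s)) := by
      rw [← Real.exp_add]; congr 1; ring
    have e2 : s ^ (a + b - 1) = s * (s ^ (a - 1) * s ^ (b - 1)) := by
      rw [← Real.rpow_add hs, mul_comm, ← Real.rpow_add_one hs.ne']; congr 1; ring
    rw [Real.mul_rpow hs.le h0.le, Real.mul_rpow hs.le h1'.le, e2, ← e1, Real.rpow_add hr,
      ProbabilityTheory.beta]
    field_simp
  · have : s - s * t < 0 := by nlinarith
    rw [gammaPDF_of_neg this, betaPDF_eq_zero_of_one_le h1.le]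
    simp

/-- If `X` and `Y` are independent gamma variables of shapes `a`, `b` and common rate, then `X + Y`
and `X / (X + Y)` are independent with gamma law of shape `a + b` and beta law `(a, b)`. -/
theorem map_gammaMeasure_prod {a b r : ℝ} (ha : 0 < a) (hb : 0 < b) (hr : 0 < r) :
    ((gammaMeasure a r).prod (gammaMeasure b r)).map (fun p => (p.1 + p.2, p.1 / (p.1 + p.2))) =
      (gammaMeasure (a + b) r).prod (betaMeasure a b) := by
  have := isProbabilityMeasure_gammaMeasure ha hr
  have := isProbabilityMeasure_gammaMeasure hb hr
  have := isProbabilityMeasure_gammaMeasure (add_pos ha hb) hr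
  have := isProbabilityMeasureBeta ha hb
  have mg := measurable_gammaPDF
  have mb := measurable_betaPDF
  refine Measure.ext_of_lintegral _ fun f hf => ?_
  rw [lintegral_map hf (by fun_prop), lintegral_prod _ (by fun_prop),
    lintegral_prod _ (by fun_prop)]
  simp only [gammaMeasure, betaMeasure]
  rw [lintegral_withDensity_eq_lintegral_mul _ (mg a r) ?_,
    lintegral_withDensity_eq_lintegral_mul _ (mg (a + b) r) ?_]
  rotate_left
  · exact Measurable.lintegral_prod_right (ν := betaMeasure a b) hf
  · exact Measurable.lintegral_prod_right (ν := gammaMeasure b r)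
      (f := fun x y => f (x + y, x / (x + y))) (by fun_prop)
  calc ∫⁻ x, gammaPDF a r x * ∫⁻ y, f (x + y, x / (x + y)) ∂(volume.withDensity (gammaPDF b r))
      = ∫⁻ x, ∫⁻ s, gammaPDF a r x * (gammaPDF b r (s - x) * f (s, x / s)) := by
        refine lintegral_congr fun x => ?_
        rw [lintegral_withDensity_eq_lintegral_mul _ (mg b r) (by fun_prop),
          lintegral_const_mul _ (by fun_prop),
          -- Shift `y = s - x`, so that `s` is the sum.
          ← lintegral_sub_right_eq_self _ x]
        simp
    _ = ∫⁻ s, ∫⁻ x, gammaPDF a r x * (gammaPDF b r (s - x) * f (s, x / s)) :=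
        lintegral_lintegral_swap (Measurable.aemeasurable (by fun_prop))
    _ = ∫⁻ s, gammaPDF (a + b) r s * ∫⁻ t, f (s, t) ∂(volume.withDensity (betaPDF a b)) := by
        refine lintegral_congr_ae ?_
        have h0 : ∀ᵐ s : ℝ, s ≠ 0 := Measure.ae_ne volume 0
        filter_upwards [h0] with s hs
        rcases lt_or_gt_of_ne hs with hs | hs
        · rw [gammaPDF_of_neg hs, zero_mul, ← lintegral_zero (μ := (volume : Measure ℝ))]
          refine lintegral_congr fun x => ?_
          rcases lt_or_ge x 0 with hx | hx
          · rw [gammaPDF_of_neg hx, zero_mul]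
          · rw [gammaPDF_of_neg (show s - x < 0 by linarith), zero_mul, mul_zero]
        -- Substitute `x = s * t`, so that `t` is the ratio.
        · rw [lintegral_withDensity_eq_lintegral_mul _ (mb a b) (by fun_prop),
            lintegral_eq_mul_lintegral_comp_mul_left hs _ (by fun_prop),
            ← lintegral_const_mul _ (by fun_prop), ← lintegral_const_mul _ (by fun_prop)]
          refine lintegral_congr_ae ?_
          -- The density identity can fail at the endpoints, where `betaPDF` is zero but a gamma
          -- density need not be.
          filter_upwards [Measure.ae_ne volume (0 : ℝ), Measure.ae_ne volume (1 : ℝ)] with t h0 h1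
          rw [Pi.mul_apply, mul_div_cancel_left₀ _ hs.ne', ← mul_assoc (gammaPDF (a + b) r s),
            ← gammaPDF_mul_gammaPDF ha hb hr hs h0 h1]
          ring

/-! ### Chi-squared laws from Gaussians. -/

/-- Restricted to the positive half-line, the square of a standard Gaussian variable has half of
the gamma law of shape and rate `1 / 2`. -/
lemma map_sq_restrict_Ioi_gaussianReal :
    ((gaussianReal 0 1).restrict (Set.Ioi 0)).map (fun x => x ^ 2) =
      (2⁻¹ : ℝ≥0∞) • gammaMeasure (1 / 2) (1 / 2) := by
  have mg := measurable_gammaPDF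
  refine Measure.ext_of_lintegral _ fun f hf => ?_
  rw [lintegral_map hf (by fun_prop), gaussianReal_of_var_ne_zero _ one_ne_zero,
    restrict_withDensity measurableSet_Ioi,
    lintegral_withDensity_eq_lintegral_mul _ (measurable_gaussianPDF 0 1) (by fun_prop),
    lintegral_smul_measure, gammaMeasure,
    lintegral_withDensity_eq_lintegral_mul _ (mg _ _) hf]
  have h1 : ∫⁻ u, (gammaPDF (1 / 2) (1 / 2) * f) u =
      ∫⁻ u in Set.Ioi 0, (gammaPDF (1 / 2) (1 / 2) * f) u := by
    rw [← lintegral_add_compl _ (measurableSet_Ioi (a := (0 : ℝ))), Set.compl_Ioi,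
      setLIntegral_congr Iio_ae_eq_Iic.symm,
      setLIntegral_congr_fun (g := fun _ => 0) measurableSet_Iio, lintegral_zero, add_zero]
    intro x hx
    simp [gammaPDF_of_neg (Set.mem_Iio.1 hx)]
  have h2 : (fun x : ℝ => x ^ 2) '' Set.Ioi 0 = Set.Ioi 0 := by
    ext y
    refine ⟨?_, fun hy => ⟨√y, Real.sqrt_pos.2 hy, Real.sq_sqrt (le_of_lt hy)⟩⟩
    rintro ⟨x, hx, rfl⟩
    exact pow_pos (Set.mem_Ioi.1 hx) 2
  have h3 : Set.InjOn (fun x : ℝ => x ^ 2) (Set.Ioi 0) := fun x hx y hy h =>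
    (pow_left_inj₀ (le_of_lt hx) (le_of_lt hy) two_ne_zero).1 h
  rw [h1]
  conv_rhs => rw [← h2]
  -- Change of variables `u = x ^ 2`: the Jacobian `2 * x` cancels the factor `u ^ (-1/2)` of the
  -- gamma density up to a constant.
  rw [lintegral_image_eq_lintegral_abs_deriv_mul measurableSet_Ioi
    (fun x _ => (hasDerivAt_pow 2 x).hasDerivWithinAt) h3, smul_eq_mul,
    ← lintegral_const_mul _ (by fun_prop)]
  refine setLIntegral_congr_fun measurableSet_Ioi fun x hx => ?_
  have hx : 0 < x := hx
  simp only [Pi.mul_apply]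
  rw [← mul_assoc, ← mul_assoc]
  congr 1
  have h2' : (2⁻¹ : ℝ≥0∞) = ENNReal.ofReal 2⁻¹ := by
    rw [ENNReal.ofReal_inv_of_pos two_pos]; simp
  rw [gammaPDF_of_nonneg (by positivity), gaussianPDF, h2', ← ENNReal.ofReal_mul (by positivity),
    ← ENNReal.ofReal_mul (by positivity)]
  congr 1
  rw [gaussianPDFReal, Real.Gamma_one_half_eq, ← Real.sqrt_eq_rpow,
    ← Real.rpow_natCast x 2, ← Real.rpow_mul hx.le]
  have e : ((2 : ℕ) : ℝ) * (1 / 2 - 1) = -1 := by norm_num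
  rw [e, Real.rpow_neg_one, abs_of_pos (by positivity)]
  have e2 : √(1 / 2 : ℝ) * √2 = 1 := by rw [← Real.sqrt_mul (by norm_num)]; norm_num
  simp only [NNReal.coe_one, mul_one, sub_zero, Real.rpow_natCast]
  rw [Real.sqrt_mul (by norm_num), neg_div, show 1 / 2 * x ^ 2 = x ^ 2 / 2 by ring]
  have : 0 < √Real.pi := Real.sqrt_pos.2 Real.pi_pos
  have e3 : √(1 / 2 : ℝ) = (√2)⁻¹ := eq_inv_of_mul_eq_one_left e2
  rw [e3]
  field_simp
  norm_num [mul_comm]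

lemma map_sq_gaussianReal :
    (gaussianReal 0 1).map (fun x => x ^ 2) = gammaMeasure (1 / 2) (1 / 2) := by
  -- Both half-lines contribute equally, by the symmetry `x ↦ -x`.
  have hneg : ((gaussianReal 0 1).restrict (Set.Iio 0)).map (fun x => x ^ 2) =
      ((gaussianReal 0 1).restrict (Set.Ioi 0)).map (fun x => x ^ 2) := by
    have h := gaussianReal_map_neg (μ := 0) (v := 1)
    rw [neg_zero] at h
    conv_rhs => rw [← h]
    rw [Measure.restrict_map (by fun_prop) measurableSet_Ioi,
      Measure.map_map (by fun_prop) (by fun_prop)]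
    congr 1
    · ext x; simp
    · congr 1; ext x; simp
  have hsplit : gaussianReal 0 1 = (gaussianReal 0 1).restrict (Set.Ioi 0) +
      (gaussianReal 0 1).restrict (Set.Iio 0) := by
    have := nullSingletonClass_gaussianReal (μ := 0) (one_ne_zero (α := NNReal))
    conv_lhs => rw [← Measure.restrict_add_restrict_compl (μ := gaussianReal 0 1)
      (measurableSet_Ioi (a := (0 : ℝ)))]
    rw [Set.compl_Ioi, Measure.restrict_congr_set Iio_ae_eq_Iic.symm]
  rw [hsplit, Measure.map_add _ _ (by fun_prop), hneg, map_sq_restrict_Ioi_gaussianReal,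
    ← add_smul, ENNReal.inv_two_add_inv_two, one_smul]

/-- First marginal of the beta-gamma factorization. -/
lemma map_add_gammaMeasure_prod {a b r : ℝ} (ha : 0 < a) (hb : 0 < b) (hr : 0 < r) :
    ((gammaMeasure a r).prod (gammaMeasure b r)).map (fun p => p.1 + p.2) =
      gammaMeasure (a + b) r := by
  have := isProbabilityMeasureBeta ha hb
  have h := congrArg (Measure.map Prod.fst) (map_gammaMeasure_prod ha hb hr)
  rwa [Measure.map_map (by fun_prop) (by fun_prop), Measure.map_fst_prod, measure_univ,
    one_smul] at h

/-- The sum of the squares of independent standard Gaussian variables has the chi-squared law. -/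
lemma map_sum_sq_pi_gaussianReal (n : ℕ) :
    (Measure.pi fun _ : Fin (n + 1) => gaussianReal 0 1).map (fun x => ∑ i, x i ^ 2) =
      gammaMeasure ((n + 1 : ℕ) / 2) (1 / 2) := by
  induction n with
  | zero =>
    have h := (measurePreserving_eval (fun _ : Fin 1 => gaussianReal 0 1) 0).map_eq
    simp only [Fin.sum_univ_succ, Finset.univ_eq_empty, Finset.sum_empty, add_zero, zero_add,
      Nat.cast_one]
    rw [← map_sq_gaussianReal]
    conv_rhs => rw [← h]
    rw [Measure.map_map (by fun_prop) (by fun_prop)]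
    rfl
  | succ n ih =>
    have e := measurePreserving_piFinSuccAbove (fun _ : Fin (n + 2) => gaussianReal 0 1) 0
    have hf : (fun x : Fin (n + 2) → ℝ => ∑ i, x i ^ 2) = (fun p : ℝ × ℝ => p.1 + p.2) ∘
        (Prod.map (fun x : ℝ => x ^ 2) (fun x : Fin (n + 1) → ℝ => ∑ i, x i ^ 2)) ∘
        (MeasurableEquiv.piFinSuccAbove (fun _ : Fin (n + 2) => ℝ) 0) := by
      ext x
      simp [Fin.sum_univ_succ, MeasurableEquiv.piFinSuccAbove, Fin.tail]
    rw [hf, ← Measure.map_map (by fun_prop) (by fun_prop),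
      ← Measure.map_map (by fun_prop) (by fun_prop), e.map_eq,
      ← Measure.map_prod_map _ _ (by fun_prop) (by fun_prop), ih, map_sq_gaussianReal,
      map_add_gammaMeasure_prod (by norm_num) (by positivity) (by norm_num)]
    congr 1
    push_cast
    ring

/-! ### The radial and angular factors. -/

lemma gammaMeasure_real_Ioc {d : ℕ} (hd : 0 < d) {R₁ R₂ : ℝ} (hR₁ : 0 ≤ R₁) (hR : R₁ ≤ R₂) :
    (gammaMeasure ((d : ℝ) / 2) (1 / 2)).real (Set.Ioc (R₁ ^ 2) (R₂ ^ 2)) = deltaPsi d R₁ R₂ := by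
  have := isProbabilityMeasure_gammaMeasure (a := (d : ℝ) / 2) (r := 1 / 2) (by positivity)
    (by norm_num)
  rw [deltaPsi, Psi, Psi, if_pos hR₁, if_pos (hR₁.trans hR), chiSqCDF, chiSqCDF, cdf_eq_real,
    cdf_eq_real, ← Set.Iic_sdiff_Iic, measureReal_sdiff (Set.Iic_subset_Iic.2 (by gcongr))
      measurableSet_Iic]
  ring

lemma betaMeasure_real_Iic {a b x : ℝ} (ha : 0 < a) (hb : 0 < b) (hx0 : 0 ≤ x) (hx1 : x ≤ 1) :
    (betaMeasure a b).real (Set.Iic x) = regIncBeta x a b := by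
  have hβ := beta_pos ha hb
  rw [measureReal_def, betaMeasure, withDensity_apply _ measurableSet_Iic, regIncBeta,
    ← intervalIntegral.integral_const_mul, intervalIntegral.integral_of_le hx0,
    integral_Ioc_eq_integral_Ioo, integral_eq_lintegral_of_nonneg_ae]
  · congr 1
    rw [← Set.Iic_union_Ioc_eq_Iic hx0, lintegral_union measurableSet_Ioc
      (Set.Iic_disjoint_Ioc le_rfl), setLIntegral_congr_fun (g := fun _ => 0) measurableSet_Iic
      (fun t ht => betaPDF_eq_zero_of_nonpos ht), lintegral_zero, zero_add,
      setLIntegral_congr Ioo_ae_eq_Ioc.symm]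
    refine setLIntegral_congr_fun measurableSet_Ioo fun t ht => ?_
    rw [betaPDF_of_pos_lt_one ht.1 (ht.2.trans_le hx1), mul_assoc]
  · refine ae_restrict_of_forall_mem measurableSet_Ioo fun t ht => ?_
    have : 0 < t := ht.1
    have : 0 < 1 - t := by linarith [ht.2]
    simp only [Pi.zero_apply]
    positivity
  · exact Measurable.aestronglyMeasurable (by fun_prop)

/-! ### Geometry of the shell. -/

lemma mem_sectorShell_zero {d : ℕ} {v x : EuclideanSpace ℝ (Fin d)} {R₁ R₂ θ : ℝ} :
    x ∈ sectorShell 0 R₂ R₁ v θ ↔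
      ‖x‖ ∈ Set.Ioc R₁ R₂ ∧ ‖x‖ * ‖v‖ * Real.cos θ ≤ inner ℝ x v := by
  simp only [sectorShell, sector, Set.mem_sdiff, Set.mem_ofPred_eq, Metric.mem_closedBall,
    dist_zero_right, sub_zero, Set.mem_Ioc, not_and, not_le]
  constructor
  · rintro ⟨⟨h1, h2⟩, h3⟩
    exact ⟨⟨lt_of_not_ge fun h => (h3 h).not_ge h2, h1⟩, h2⟩
  · rintro ⟨⟨h1, h2⟩, h3⟩
    exact ⟨⟨h2, h3⟩, fun h => absurd h h1.not_ge⟩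

lemma measurableSet_sectorShell_zero {d : ℕ} {v : EuclideanSpace ℝ (Fin d)} {R₁ R₂ θ : ℝ} :
    MeasurableSet (sectorShell 0 R₂ R₁ v θ) := by
  have : sectorShell 0 R₂ R₁ v θ =
      {x | ‖x‖ ∈ Set.Ioc R₁ R₂} ∩ {x | ‖x‖ * ‖v‖ * Real.cos θ ≤ inner ℝ x v} := by
    ext x
    exact mem_sectorShell_zero
  rw [this]
  exact (measurable_norm measurableSet_Ioc).inter (measurableSet_le (by fun_prop) (by fun_prop))

lemma exists_orthonormalBasis_zero_eq {n : ℕ} {v : EuclideanSpace ℝ (Fin (n + 1))} (hv : v ≠ 0) :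
    ∃ b : OrthonormalBasis (Fin (n + 1)) ℝ (EuclideanSpace ℝ (Fin (n + 1))),
      v = ‖v‖ • b 0 := by
  have hv' : ‖v‖ ≠ 0 := norm_ne_zero_iff.2 hv
  have ho : Orthonormal ℝ (({0} : Set (Fin (n + 1))).domRestrict fun _ => ‖v‖⁻¹ • v) := by
    refine ⟨fun i => by simp [Set.domRestrict, norm_smul, hv'], fun i j hij => ?_⟩
    exact absurd (Subsingleton.elim i j) hij
  obtain ⟨b, hb⟩ := ho.exists_orthonormalBasis_extension_of_card_eq (by simp)
  refine ⟨b, ?_⟩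
  rw [hb 0 rfl, smul_smul, mul_inv_cancel₀ hv', one_smul]

/-- In coordinates where the first one is the component `x` along the axis and `y` is the squared
norm of the orthogonal part, the angle condition is a condition on the ratio `y / (y + x ^ 2)`. -/
lemma sqrt_mul_cos_le_iff {c x y : ℝ} (hc : 0 ≤ c) (hx : 0 < x) (hy : 0 ≤ y) :
    √(y + x ^ 2) * c ≤ x ↔ y / (y + x ^ 2) ≤ 1 - c ^ 2 := by
  have hs : 0 < y + x ^ 2 := by positivity
  -- Both sides are nonnegative, so squaring loses nothing.
  rw [div_le_iff₀ hs, ← pow_le_pow_iff_left₀ (by positivity) hx.le two_ne_zero, mul_pow,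
    Real.sq_sqrt hs.le]
  constructor <;> intro h <;> linarith

lemma sqrt_mem_Ioc_iff {R₁ R₂ s : ℝ} (hR₁ : 0 ≤ R₁) (hR : R₁ ≤ R₂) :
    √s ∈ Set.Ioc R₁ R₂ ↔ s ∈ Set.Ioc (R₁ ^ 2) (R₂ ^ 2) := by
  rw [Set.mem_Ioc, Set.mem_Ioc, Real.lt_sqrt hR₁, Real.sqrt_le_left (hR₁.trans hR)]

/-! ### Probability of the shell. -/

theorem stdGaussian_sectorShell {n : ℕ} (hn : 1 ≤ n) {R₁ R₂ : ℝ} (hR₁ : 0 ≤ R₁) (hR : R₁ ≤ R₂)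
    {v : EuclideanSpace ℝ (Fin (n + 1))} (hv : v ≠ 0) {θ : ℝ} (hc : 0 ≤ Real.cos θ) :
    stdGaussian (EuclideanSpace ℝ (Fin (n + 1))) (sectorShell 0 R₂ R₁ v θ) =
      2⁻¹ * (gammaMeasure ((n + 1 : ℕ) / 2) (1 / 2) (Set.Ioc (R₁ ^ 2) (R₂ ^ 2)) *
        betaMeasure (n / 2) (1 / 2) (Set.Iic (1 - Real.cos θ ^ 2))) := by
  -- At least one orthogonal coordinate remains, so the shape of `Y` is positive.
  obtain ⟨m, rfl⟩ : ∃ m, n = m + 1 := ⟨n - 1, by omega⟩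
  obtain ⟨b, hb⟩ := exists_orthonormalBasis_zero_eq hv
  set c := Real.cos θ
  have hA : (0 : ℝ) < (m + 1 : ℕ) / 2 := by positivity
  have := isProbabilityMeasure_gammaMeasure hA (one_half_pos (α := ℝ))
  have := isProbabilityMeasure_gammaMeasure (one_half_pos (α := ℝ)) (one_half_pos (α := ℝ))
  have := isProbabilityMeasureBeta hA (one_half_pos (α := ℝ))
  have hS := measurableSet_sectorShell_zero (v := v) (R₁ := R₁) (R₂ := R₂) (θ := θ)
  have e := measurePreserving_piFinSuccAbove (fun _ : Fin (m + 2) => gaussianReal 0 1) 0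
  -- The swap puts the orthogonal part first: the ratio is then sin² of the angle to the axis.
  let g : ℝ × (Fin (m + 1) → ℝ) → ℝ × ℝ := 
    Prod.swap ∘ Prod.map (fun x : ℝ => x ^ 2) (fun x : Fin (m + 1) → ℝ => ∑ i, x i ^ 2)
  have hg : Measurable g := by fun_prop
  let h : ℝ × ℝ → ℝ × ℝ := fun p => (p.1 + p.2, p.1 / (p.1 + p.2))
  have hh : Measurable h := by fun_prop
  let T : Set (ℝ × ℝ) := Set.Ioc (R₁ ^ 2) (R₂ ^ 2) ×ˢ Set.Iic (1 - c ^ 2)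
  have hT : MeasurableSet T := measurableSet_Ioc.prod measurableSet_Iic
  have hmem : ∀ x : Fin (m + 2) → ℝ, x 0 ≠ 0 →
      (∑ i, x i • b i ∈ sectorShell 0 R₂ R₁ v θ ↔
        x 0 ∈ Set.Ioi (0 : ℝ) ∧ h (g (x 0, Fin.tail x)) ∈ T) := by
    intro x hx0
    have hb0 : ∀ i, inner ℝ (b i) (∑ i, x i • b i) = x i := fun i =>
      b.orthonormal.inner_right_fintype x i
    have hnorm : ‖∑ i, x i • b i‖ = √(∑ i : Fin (m + 1), Fin.tail x i ^ 2 + x 0 ^ 2) := by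
      rw [← Real.sqrt_sq (norm_nonneg _), ← b.sum_sq_inner_right, Fin.sum_univ_succ, add_comm]
      simp only [hb0, Fin.tail]
    have hin : inner ℝ (∑ i, x i • b i) v = ‖v‖ * x 0 := by
      rw [real_inner_comm]
      conv_lhs => rw [hb]
      rw [real_inner_smul_left, hb0]
    have hvp : 0 < ‖v‖ := norm_pos_iff.2 hv
    rw [mem_sectorShell_zero, hin, hnorm, sqrt_mem_Ioc_iff hR₁ hR,
      mul_right_comm, mul_comm _ ‖v‖, mul_le_mul_iff_right₀ hvp]
    have hy : 0 ≤ ∑ i : Fin (m + 1), Fin.tail x i ^ 2 := Finset.sum_nonneg fun i _ => sq_nonneg _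
    rcases lt_or_gt_of_ne hx0 with hlt | hgt
    -- Since `cos θ ≥ 0`, the sector lies in the half-space `0 ≤ x 0`.
    · refine iff_of_false (fun H => ?_) (fun H => hlt.not_gt H.1)
      have : 0 ≤ x 0 := le_trans (by positivity) H.2
      exact hlt.not_ge this
    · rw [sqrt_mul_cos_le_iff hc hgt hy]
      simp only [T, h, g, Set.mem_prod, Set.mem_Ioi, hgt, true_and, Set.mem_Iic,
        Function.comp_apply, Prod.map_apply, Prod.swap_prod_mk]
  -- For `θ = π / 2` the sector contains points with `x 0 = 0`, which `hmem` leaves out.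
  have hae : ∀ᵐ x ∂(Measure.pi fun _ : Fin (m + 2) => gaussianReal 0 1), x 0 ≠ 0 := by
    have := nullSingletonClass_gaussianReal (μ := 0) (one_ne_zero (α := NNReal))
    exact (measurePreserving_eval (fun _ : Fin (m + 2) => gaussianReal 0 1)
      0).quasiMeasurePreserving.ae (Measure.ae_ne (gaussianReal 0 1) (0 : ℝ))
  have hlaw : (((gaussianReal 0 1).restrict (Set.Ioi 0)).prod
      (Measure.pi fun _ : Fin (m + 1) => gaussianReal 0 1)).map g =
      (2⁻¹ : ℝ≥0∞) • (gammaMeasure ((m + 1 : ℕ) / 2) (1 / 2)).prod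
        (gammaMeasure (1 / 2) (1 / 2)) := by
    rw [← Measure.map_map measurable_swap (by fun_prop),
      ← Measure.map_prod_map _ _ (by fun_prop) (by fun_prop), map_sq_restrict_Ioi_gaussianReal,
      map_sum_sq_pi_gaussianReal, Measure.prod_smul_left, Measure.map_smul, Measure.prod_swap]
  calc stdGaussian (EuclideanSpace ℝ (Fin (m + 2))) (sectorShell 0 R₂ R₁ v θ)
      = (Measure.pi fun _ : Fin (m + 2) => gaussianReal 0 1)
          ((MeasurableEquiv.piFinSuccAbove (fun _ : Fin (m + 2) => ℝ) 0) ⁻¹'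
            (((h ∘ g) ⁻¹' T) ∩ (Set.Ioi 0 ×ˢ Set.univ))) := by
        rw [stdGaussian_eq_map_pi_orthonormalBasis b, Measure.map_apply (by fun_prop) hS]
        refine measure_congr ?_
        filter_upwards [hae] with x hx
        refine propext ((hmem x hx).trans ?_)
        exact ⟨fun H => ⟨H.2, H.1, trivial⟩, fun H => ⟨H.2.1, H.1⟩⟩
    _ = (((gaussianReal 0 1).restrict (Set.Ioi 0)).prod
          (Measure.pi fun _ : Fin (m + 1) => gaussianReal 0 1)) ((h ∘ g) ⁻¹' T) := by
        have hTm := (hh.comp hg) hT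
        rw [e.measure_preimage (hTm.inter
          (measurableSet_Ioi.prod MeasurableSet.univ)).nullMeasurableSet]
        -- The condition `x 0 > 0` becomes a restriction of the first Gaussian, whence the factor
        -- 1/2.
        conv_rhs => rw [← Measure.restrict_univ (μ := Measure.pi _)]
        rw [Measure.prod_restrict, Measure.restrict_apply hTm]
    _ = 2⁻¹ * (gammaMeasure ((m + 1 + 1 : ℕ) / 2) (1 / 2) (Set.Ioc (R₁ ^ 2) (R₂ ^ 2)) *
          betaMeasure ((m + 1 : ℕ) / 2) (1 / 2) (Set.Iic (1 - c ^ 2))) := by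
        rw [← Measure.map_apply (hh.comp hg) hT, ← Measure.map_map hh hg, hlaw, Measure.map_smul,
          map_gammaMeasure_prod hA one_half_pos one_half_pos, Measure.smul_apply, smul_eq_mul,
          Measure.prod_prod]
        congr 4
        push_cast
        ring

end SphericalSector

theorem mainTheorem2 {Ω : Type*} [MeasurableSpace Ω] (P : Measure Ω) [IsProbabilityMeasure P]
    (d : ℕ) (hd : 2 ≤ d) (z : Ω → EuclideanSpace ℝ (Fin d))
    (hz : HasLaw z (multivariateGaussian 0 (1 : Matrix (Fin d) (Fin d) ℝ)) P)
    (R₁ R₂ : ℝ) (hR₁ : 0 ≤ R₁) (hR : R₁ ≤ R₂)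
    (v : EuclideanSpace ℝ (Fin d)) (hv : v ≠ 0)
    (θ : ℝ) (hθ : θ ∈ Set.Icc 0 (Real.pi / 2)) :
    P.real {ω | z ω ∈ SphericalSector.sectorShell 0 R₂ R₁ v θ} =
      SphericalSector.sectorI d (Real.cos θ) / 2 * SphericalSector.deltaPsi d R₁ R₂ := by
  obtain ⟨n, rfl⟩ : ∃ n, d = n + 1 := ⟨d - 1, by omega⟩
  have hn : 1 ≤ n := by omega
  have hn' : (0 : ℝ) < n := by exact_mod_cast hn
  have hc : 0 ≤ Real.cos θ :=
    Real.cos_nonneg_of_neg_pi_div_two_le_of_le (by linarith [hθ.1, Real.pi_pos]) hθ.2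
  have hc1 := Real.cos_le_one θ
  have hS : MeasurableSet (SphericalSector.sectorShell 0 R₂ R₁ v θ) :=
    SphericalSector.measurableSet_sectorShell_zero
  have hset : P {ω | z ω ∈ SphericalSector.sectorShell 0 R₂ R₁ v θ} =
      stdGaussian (EuclideanSpace ℝ (Fin (n + 1))) (SphericalSector.sectorShell 0 R₂ R₁ v θ) := by
    rw [← multivariateGaussian_zero_one, ← hz.map_eq,
      Measure.map_apply_of_aemeasurable hz.aemeasurable hS]
    rfl
  rw [measureReal_def, hset, SphericalSector.stdGaussian_sectorShell hn hR₁ hR hv hc,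
    ENNReal.toReal_mul, ENNReal.toReal_mul, ← measureReal_def, ← measureReal_def,
    SphericalSector.gammaMeasure_real_Ioc n.succ_pos hR₁ hR,
    SphericalSector.betaMeasure_real_Iic (by positivity) one_half_pos (by nlinarith)
      (by nlinarith), SphericalSector.sectorI]
  simp only [Nat.cast_add, Nat.cast_one, add_sub_cancel_right, ENNReal.toReal_inv,
    ENNReal.toReal_ofNat]
  ring
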